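/- Let $m\equiv 3\pmod 4$ and $n\equiv 1\pmod 4$ be two distinct square-free positive integers, let $K=\mathbb{Q}(\sqrt{-m},\sqrt{n})$, and let $\mathcal{O}_K$ be its ring of integers. Let $g(\mathcal{O}_K)$ denote the smallest positive integer $t$ such that every element of $\mathcal{O}_K$ is a sum of $t$ squares of elements of $\mathcal{O}_K$ (zero summands allowed). For distinct primes $p,q,r$, with $\left(\frac{\cdot}{\cdot}\right)$ the Legendre symbol, the following hold (each time, such a $t$ exists). (I) If $m=p$ with $p\equiv 3\pmod 8$, then $g(\mathcal{O}_K)=3$. (II) If $m=pq$ with $p\equiv 3\pmod 8$, $q\equiv 1\pmod 8$ and $\left(\frac{p}{q}\right)=-1$, then $g(\mathcal{O}_K)=3$. (III) If $m=pqr$ with $p\equiv q\equiv r\equiv 3\pmod 8$ and $\left(\frac{p}{q}\right)=\left(\frac{q}{r}\right)=\left(\frac{r}{p}\right)=-1$, then $g(\mathcal{O}_K)=3$. -/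

import Mathlib

open NumberField

/-- The field `ℚ(√-m, √n)`, as a subfield of `ℂ`, for natural numbers `m` and `n`;
here `√-m = i √m`. -/
noncomputable def fieldK (m n : ℕ) : IntermediateField ℚ ℂ :=
  IntermediateField.adjoin ℚ {Complex.I * (Real.sqrt m : ℂ), (Real.sqrt n : ℂ)}

/-- `α` is a sum of `t` squares in `R` (some of which may be zero). -/
def IsSumOfSquares {R : Type*} [CommRing R] (t : ℕ) (α : R) : Prop :=
  ∃ β : Fin t → R, α = ∑ i, β i ^ 2

/-- `g(R) = k`: the number `k` is the smallest positive integer `t` such that every element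
of `R` is a sum of `t` squares in `R` (in particular, such a `t` exists). -/
def GEq (R : Type*) [CommRing R] (k : ℕ) : Prop :=
  IsLeast {t : ℕ | 0 < t ∧ ∀ α : R, IsSumOfSquares t α} k

/-! In all three cases `m ≡ 3 (mod 8)`, so `2` is inert in `ℚ(√-m)` and unramified in `K`, and `𝓞 K
/ 2` is a product of copies of `𝔽₄`: every integer satisfies `x ^ 4 ≡ x (mod 2)`. Both bounds rest
on this congruence.

Upper bound (`isSumOfSquares_three`): if `-1 = a² + b²` and `(1 - α)⁴ = (1 - α) + 2d`, then `α = (1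
+ d)² - (d² + (1 - α)⁴)`, and minus a sum of two squares is again a sum of two squares. A solution
of `u² - m w² = -2` gives `-1 = ((u + w√-m)/2)² + ((-u + w√-m)/2)²`.

That equation comes from descent on the fundamental solution of `T² - m U² = 1`
(`exists_sq_sub_mul_sq_eq_neg_two`): factoring `T² - 1` yields `d₁ x² - d₂ y² ∈ {1, 2}` with `d₁ d₂
= m`. The Legendre symbol conditions exclude the nontrivial factorizations, and minimality and
congruences mod 8 leave only the desired one.

Lower bound (`not_sum_two_squares`): `2 + √-m` is not a sum of two squares. -/

/-! ### Legendre symbols and the equation `u² - m w² = -2`. -/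

theorem legendreSym_eq_of_dvd_mul_sq_sub {q : ℕ} [Fact q.Prime] {d x c : ℤ}
    (h : (q : ℤ) ∣ d * x ^ 2 - c) (hc : legendreSym q c ≠ 0) :
    legendreSym q d = legendreSym q c := by
  have h1 : legendreSym q (d * x ^ 2) = legendreSym q c := by
    rw [legendreSym.mod q (d * x ^ 2), legendreSym.mod q c]
    congr 1
    exact ((Int.modEq_iff_dvd).2 h).symm
  rw [legendreSym.mul] at h1
  have hx : (x : ZMod q) ≠ 0 := by
    intro hx
    have : legendreSym q (x ^ 2) = 0 := by
      rw [legendreSym.eq_zero_iff]; push_cast; rw [hx]; simp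
    rw [this, mul_zero] at h1
    exact hc h1.symm
  rw [legendreSym.sq_one' q hx, mul_one] at h1
  exact h1

theorem legendreSym_two_of_three_mod_eight {q : ℕ} [Fact q.Prime] (h : q ≡ 3 [MOD 8]) :
    legendreSym q 2 = -1 := by
  have h8 : q % 8 = 3 := h
  rw [legendreSym.at_two (by rintro rfl; omega), ZMod.χ₈_nat_eq_if_mod_eight]
  simp [h8]; omega

theorem legendreSym_two_of_one_mod_eight {q : ℕ} [Fact q.Prime] (h : q ≡ 1 [MOD 8]) :
    legendreSym q 2 = 1 := by
  have h8 : q % 8 = 1 := h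
  rw [legendreSym.at_two (by rintro rfl; omega), ZMod.χ₈_nat_eq_if_mod_eight]
  simp [h8]; omega

theorem legendreSym_neg_of_three_mod_four {q : ℕ} [Fact q.Prime] (h : q % 4 = 3) (d : ℤ) :
    legendreSym q (-d) = -legendreSym q d := by
  rw [← neg_one_mul, legendreSym.mul, legendreSym.at_neg_one (by rintro rfl; omega),
    ZMod.χ₄_nat_three_mod_four h, neg_one_mul]

theorem legendreSym_neg_of_one_mod_four {q : ℕ} [Fact q.Prime] (h : q % 4 = 1) (d : ℤ) :
    legendreSym q (-d) = legendreSym q d := by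
  rw [← neg_one_mul, legendreSym.mul, legendreSym.at_neg_one (by rintro rfl; omega),
    ZMod.χ₄_nat_one_mod_four h, one_mul]

/-- Take `d₁ = gcd(m, A)` and `d₂ = gcd(m, B)`; the cofactors are coprime with product `U²`, so each
is a square. -/
theorem Nat.exists_eq_mul_sq_of_coprime_mul {A B m U : ℕ} (hm : 0 < m) (hAB : A.Coprime B)
    (h : A * B = m * U ^ 2) :
    ∃ d₁ d₂ x y, d₁ * d₂ = m ∧ A = d₁ * x ^ 2 ∧ B = d₂ * y ^ 2 := by
  have hg : m.gcd A * m.gcd B = m := by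
    rw [← Nat.Coprime.gcd_mul m hAB, h, Nat.gcd_mul_right_right]
  obtain ⟨a, ha⟩ := Nat.gcd_dvd_right m A
  obtain ⟨b, hb⟩ := Nat.gcd_dvd_right m B
  have hab : a * b = U ^ 2 := by
    refine Nat.eq_of_mul_eq_mul_left hm ?_
    calc m * (a * b) = (m.gcd A * m.gcd B) * (a * b) := by rw [hg]
      _ = (m.gcd A * a) * (m.gcd B * b) := by ring
      _ = m * U ^ 2 := by rw [← ha, ← hb, h]
  have hc : a.Coprime b :=
    (hAB.coprime_dvd_left ⟨_, ha.trans (mul_comm _ _)⟩).coprime_dvd_right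
      ⟨_, hb.trans (mul_comm _ _)⟩
  obtain ⟨x, hx⟩ := exists_eq_pow_of_mul_eq_pow (Nat.isUnit_iff.2 hc) hab
  obtain ⟨y, hy⟩ := exists_eq_pow_of_mul_eq_pow (Nat.isUnit_iff.2 hc.symm) ((mul_comm _ _).trans hab)
  exact ⟨_, _, x, y, hg, by rw [← hx]; exact ha, by rw [← hy]; exact hb⟩

theorem Int.sq_emod_eight (z : ℤ) : z ^ 2 % 8 = 0 ∨ z ^ 2 % 8 = 1 ∨ z ^ 2 % 8 = 4 := by
  have h : z % 8 = 0 ∨ z % 8 = 1 ∨ z % 8 = 2 ∨ z % 8 = 3 ∨ z % 8 = 4 ∨ z % 8 = 5 ∨ z % 8 = 6 ∨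
      z % 8 = 7 := by omega
  rcases h with h | h | h | h | h | h | h | h <;> simp [pow_two, Int.mul_emod, h]

/-- If no nontrivial factorization `m = d₁ d₂` admits solutions of `d₁ x² - d₂ y² ∈ {1, 2}`, then
the negative Pell-type equation `u² - m w² = -2` is solvable. -/
theorem exists_sq_sub_mul_sq_eq_neg_two {m : ℕ} (hm : m % 8 = 3)
    (H : ∀ d₁ d₂ : ℕ, d₁ * d₂ = m → d₁ ≠ 1 → d₂ ≠ 1 → ∀ x y c : ℤ, c = 1 ∨ c = 2 →
      (d₁ : ℤ) * x ^ 2 - d₂ * y ^ 2 ≠ c) :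
    ∃ u w : ℤ, u ^ 2 - m * w ^ 2 = -2 := by
  obtain ⟨j, hj⟩ : ∃ j, m = 8 * j + 3 := ⟨m / 8, by omega⟩
  have hmy (y : ℤ) : (m : ℤ) * y ^ 2 = 8 * (j * y ^ 2) + 3 * y ^ 2 := by rw [hj]; push_cast; ring
  have hsq : ¬ IsSquare (m : ℤ) := by
    rintro ⟨r, hr⟩
    have := Int.sq_emod_eight r
    rw [pow_two] at this
    omega
  obtain ⟨f, hf⟩ := Pell.IsFundamental.exists_of_not_isSquare (d := (m : ℤ)) (by omega) hsq
  obtain ⟨hx1, hy0, hmin⟩ := hf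
  have hprop := f.prop
  obtain ⟨T, hT⟩ := Int.eq_ofNat_of_zero_le (by omega : 0 ≤ f.x)
  obtain ⟨U, hU⟩ := Int.eq_ofNat_of_zero_le hy0.le
  rw [hT, hU] at hprop
  have hT1 : 1 < T := by omega
  have hTU : T ^ 2 = 1 + m * U ^ 2 := by zify; linarith
  -- The last hypothesis serves only `x² - m y² = 1`, where it contradicts the minimality of `T`. Of
  -- the other trivial factorizations, `x² - m y² = 2` and `m x² - y² = 1` fail mod 8, and `m x² -
  -- y² = 2` is the goal.
  have key : ∀ d₁ d₂ x y : ℕ, ∀ c : ℤ, c = 1 ∨ c = 2 → d₁ * d₂ = m →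
      (d₁ : ℤ) * x ^ 2 - d₂ * y ^ 2 = c → (c = 1 → d₁ = 1 → x < T ∧ 1 < x) →
      ∃ u w : ℤ, u ^ 2 - m * w ^ 2 = -2 := by
    intro d₁ d₂ x y c hc hd h hx
    have sx := Int.sq_emod_eight x
    have sy := Int.sq_emod_eight y
    by_cases h1 : d₁ = 1
    · subst h1
      obtain rfl : d₂ = m := by omega
      rcases hc with rfl | rfl
      · obtain ⟨h2, h3⟩ := hx rfl rfl
        have := @hmin (Pell.Solution₁.mk x y (by push_cast at h; linarith))
          (by rw [Pell.Solution₁.x_mk]; omega)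
        rw [Pell.Solution₁.x_mk] at this
        omega
      · rw [hmy] at h
        omega
    by_cases h2 : d₂ = 1
    · subst h2
      obtain rfl : d₁ = m := by omega
      rcases hc with rfl | rfl
      · rw [hmy] at h
        omega
      · exact ⟨y, x, by push_cast at h; linarith⟩
    exact absurd h (H d₁ d₂ hd h1 h2 x y c hc)
  -- For `T` even, `T + 1` and `T - 1` are coprime and differ by 2. For `T = 2k + 1`, `U` is even
  -- and `k + 1`, `k` are coprime and differ by 1.
  rcases Nat.even_or_odd' T with ⟨k, rfl | rfl⟩
  · obtain ⟨d₁, d₂, x, y, hd, hA, hB⟩ :=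
      Nat.exists_eq_mul_sq_of_coprime_mul (A := 2 * k + 1) (B := 2 * k - 1) (m := m) (U := U)
        (by omega) (by
          have := (Nat.coprime_add_self_left (m := 2) (n := 2 * k - 1)).2
            (Nat.coprime_two_left.2 ⟨k - 1, by omega⟩)
          rwa [show 2 + (2 * k - 1) = 2 * k + 1 by omega] at this) (by
          zify [show 1 ≤ 2 * k by omega] at hTU ⊢
          linarith)
    exact key d₁ d₂ x y 2 (Or.inr rfl) hd (by zify at hA hB; omega) (by norm_num)
  · have hUe : Even U := by
      rw [← Nat.not_odd_iff_even]
      intro hU'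
      have h1 : Odd (m * U ^ 2) := (Nat.odd_iff.2 (by omega)).mul hU'.pow
      have h2 : Odd ((2 * k + 1) ^ 2) := Odd.pow ⟨k, rfl⟩
      rw [Nat.odd_iff] at h1 h2
      omega
    obtain ⟨V, rfl⟩ := hUe.two_dvd
    obtain ⟨d₁, d₂, x, y, hd, hA, hB⟩ :=
      Nat.exists_eq_mul_sq_of_coprime_mul (A := k + 1) (B := k) (m := m) (U := V)
        (by omega) (by simp) (by nlinarith)
    refine key d₁ d₂ x y 1 (Or.inl rfl) hd (by zify at hA hB; omega) ?_
    rintro - rfl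
    constructor <;> nlinarith

theorem Nat.Prime.mul_eq_prime_mul {p N a b : ℕ} (hp : p.Prime) (h : a * b = p * N) :
    (∃ e, a = p * e ∧ e * b = N) ∨ (∃ e, b = p * e ∧ a * e = N) := by
  rcases hp.dvd_mul.1 (h ▸ dvd_mul_right p N) with ⟨e, rfl⟩ | ⟨e, rfl⟩
  · exact Or.inl ⟨e, rfl, Nat.eq_of_mul_eq_mul_left hp.pos (by rw [← h, mul_assoc])⟩
  · exact Or.inr ⟨e, rfl, Nat.eq_of_mul_eq_mul_left hp.pos (by rw [← h, mul_left_comm])⟩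

theorem neg_pell_prime {p : ℕ} [hp : Fact p.Prime] (h : p ≡ 3 [MOD 8]) :
    ∃ u w : ℤ, u ^ 2 - p * w ^ 2 = -2 := by
  refine exists_sq_sub_mul_sq_eq_neg_two h fun d₁ d₂ hd h1 h2 => ?_
  rcases (Nat.prime_mul_iff.1 (hd ▸ hp.out)) with h | h <;> tauto

theorem neg_pell_two_primes {p q : ℕ} [hp : Fact p.Prime] [hq : Fact q.Prime]
    (hp8 : p ≡ 3 [MOD 8]) (hq8 : q ≡ 1 [MOD 8]) (hpq : legendreSym q p = -1) :
    ∃ u w : ℤ, u ^ 2 - (p * q : ℕ) * w ^ 2 = -2 := by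
  have hm : p * q % 8 = 3 := by
    have := hp8.mul hq8
    exact this
  have hq4 : q % 4 = 1 := by have : q % 8 = 1 := hq8; omega
  refine exists_sq_sub_mul_sq_eq_neg_two hm fun d₁ d₂ hd h1 h2 x y c hc h => ?_
  -- Modulo `q`, both values of `c` and `-1` are squares while `p` is not, so neither `p x² ≡ c` nor
  -- `-p y² ≡ c` is solvable.
  have hcq : legendreSym q c = 1 := by
    rcases hc with rfl | rfl
    · exact legendreSym.at_one q
    · exact legendreSym_two_of_one_mod_eight hq8
  rcases hp.out.mul_eq_prime_mul hd with ⟨e, rfl, he⟩ | ⟨e, rfl, he⟩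
  · rcases Nat.prime_mul_iff.1 (he ▸ hq.out) with ⟨-, rfl⟩ | ⟨-, rfl⟩
    · exact h2 rfl
    · obtain rfl : d₂ = q := by omega
      have := legendreSym_eq_of_dvd_mul_sq_sub (q := d₂) (d := p) (x := x) (c := c)
        ⟨y ^ 2, by push_cast at h; linarith⟩ (by rw [hcq]; norm_num)
      rw [hcq, hpq] at this
      norm_num at this
  · rcases Nat.prime_mul_iff.1 (he ▸ hq.out) with ⟨-, rfl⟩ | ⟨-, rfl⟩
    · obtain rfl : d₁ = q := by omega
      have := legendreSym_eq_of_dvd_mul_sq_sub (q := d₁) (d := -p) (x := y) (c := c)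
        ⟨-x ^ 2, by push_cast at h; linarith⟩ (by rw [hcq]; norm_num)
      rw [hcq, legendreSym_neg_of_one_mod_four hq4, hpq] at this
      norm_num at this
    · exact h1 rfl

/-- The primes `q` and `r`, both 3 mod 8, give the same symbol to `1`, to `2` and to `-1`, but
opposite symbols to `p`. Hence `±p` cannot agree with `c` up to squares at both. -/
theorem not_dvd_and_dvd_of_legendreSym {p q r : ℕ} [Fact q.Prime] [Fact r.Prime]
    (hq8 : q ≡ 3 [MOD 8]) (hr8 : r ≡ 3 [MOD 8]) (hpq : legendreSym q p = -1)
    (hpr : legendreSym r p = 1) {d x c : ℤ} (hd : d = p ∨ d = -p) (hc : c = 1 ∨ c = 2)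
    (hq : (q : ℤ) ∣ d * x ^ 2 - c) (hr : (r : ℤ) ∣ d * x ^ 2 - c) : False := by
  have hq4 : q % 4 = 3 := by have : q % 8 = 3 := hq8; omega
  have hr4 : r % 4 = 3 := by have : r % 8 = 3 := hr8; omega
  have hcq : legendreSym q c = legendreSym r c ∧ legendreSym q c ≠ 0 := by
    rcases hc with rfl | rfl
    · simp [legendreSym.at_one]
    · simp [legendreSym_two_of_three_mod_eight hq8, legendreSym_two_of_three_mod_eight hr8]
  have h1 := legendreSym_eq_of_dvd_mul_sq_sub hq hcq.2
  have h2 := legendreSym_eq_of_dvd_mul_sq_sub hr (hcq.1 ▸ hcq.2)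
  rw [hcq.1, ← h2] at h1
  rcases hd with rfl | rfl
  · rw [hpq, hpr] at h1
    norm_num at h1
  · rw [legendreSym_neg_of_three_mod_four hq4, legendreSym_neg_of_three_mod_four hr4, hpq,
      hpr] at h1
    norm_num at h1

theorem neg_pell_three_primes {p q r : ℕ} [hp : Fact p.Prime] [hq : Fact q.Prime]
    [hr : Fact r.Prime]
    (hp8 : p ≡ 3 [MOD 8]) (hq8 : q ≡ 3 [MOD 8]) (hr8 : r ≡ 3 [MOD 8])
    (hpq : legendreSym q p = -1) (hqr : legendreSym r q = -1) (hrp : legendreSym p r = -1) :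
    ∃ u w : ℤ, u ^ 2 - (p * q * r : ℕ) * w ^ 2 = -2 := by
  have hm : p * q * r % 8 = 3 := (hp8.mul hq8).mul hr8
  have hp4 : p % 4 = 3 := by have : p % 8 = 3 := hp8; omega
  have hq4 : q % 4 = 3 := by have : q % 8 = 3 := hq8; omega
  have hr4 : r % 4 = 3 := by have : r % 8 = 3 := hr8; omega
  -- Reciprocity makes the hypotheses cyclic: each of the three primes has opposite symbols at the
  -- other two.
  have hqp : legendreSym p q = 1 := by
    rw [legendreSym.quadratic_reciprocity_three_mod_four hq4 hp4, hpq, neg_neg]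
  have hrq : legendreSym q r = 1 := by
    rw [legendreSym.quadratic_reciprocity_three_mod_four hr4 hq4, hqr, neg_neg]
  have hpr : legendreSym r p = 1 := by
    rw [legendreSym.quadratic_reciprocity_three_mod_four hp4 hr4, hrp, neg_neg]
  refine exists_sq_sub_mul_sq_eq_neg_two hm fun d₁ d₂ hd h1 h2 x y c hc h => ?_
  have cases : (d₁ = 1 ∨ d₂ = 1) ∨ (d₁ = p ∧ d₂ = q * r ∨ d₁ = q ∧ d₂ = p * r ∨
      d₁ = r ∧ d₂ = p * q) ∨ (d₂ = p ∧ d₁ = q * r ∨ d₂ = q ∧ d₁ = p * r ∨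
      d₂ = r ∧ d₁ = p * q) := by
    rw [mul_assoc] at hd
    rcases hp.out.mul_eq_prime_mul hd with ⟨e, rfl, he⟩ | ⟨e, rfl, he⟩ <;>
    rcases hq.out.mul_eq_prime_mul he with ⟨e', rfl, he'⟩ | ⟨e', rfl, he'⟩ <;>
    rcases Nat.prime_mul_iff.1 (he' ▸ hr.out) with ⟨-, rfl⟩ | ⟨-, rfl⟩ <;>
    simp only [mul_one, one_mul] at he' <;> simp [he']
  rcases cases with (h' | h') | (⟨rfl, rfl⟩ | ⟨rfl, rfl⟩ | ⟨rfl, rfl⟩) |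
    (⟨rfl, rfl⟩ | ⟨rfl, rfl⟩ | ⟨rfl, rfl⟩)
  · exact h1 h'
  · exact h2 h'
  · exact not_dvd_and_dvd_of_legendreSym hq8 hr8 hpq hpr (d := d₁) (x := x) (c := c)
      (Or.inl rfl) hc ⟨r * y ^ 2, by push_cast at h; linarith⟩
      ⟨q * y ^ 2, by push_cast at h; linarith⟩
  · exact not_dvd_and_dvd_of_legendreSym hr8 hp8 hqr hqp (d := d₁) (x := x) (c := c)
      (Or.inl rfl) hc ⟨p * y ^ 2, by push_cast at h; linarith⟩
      ⟨r * y ^ 2, by push_cast at h; linarith⟩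
  · exact not_dvd_and_dvd_of_legendreSym hp8 hq8 hrp hrq (d := d₁) (x := x) (c := c)
      (Or.inl rfl) hc ⟨q * y ^ 2, by push_cast at h; linarith⟩
      ⟨p * y ^ 2, by push_cast at h; linarith⟩
  · exact not_dvd_and_dvd_of_legendreSym hq8 hr8 hpq hpr (d := -d₂) (x := y) (c := c)
      (Or.inr rfl) hc ⟨-r * x ^ 2, by push_cast at h; linarith⟩
      ⟨-q * x ^ 2, by push_cast at h; linarith⟩
  · exact not_dvd_and_dvd_of_legendreSym hr8 hp8 hqr hqp (d := -d₂) (x := y) (c := c)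
      (Or.inr rfl) hc ⟨-p * x ^ 2, by push_cast at h; linarith⟩
      ⟨-r * x ^ 2, by push_cast at h; linarith⟩
  · exact not_dvd_and_dvd_of_legendreSym hp8 hq8 hrp hrq (d := -d₂) (x := y) (c := c)
      (Or.inr rfl) hc ⟨-q * x ^ 2, by push_cast at h; linarith⟩
      ⟨-p * x ^ 2, by push_cast at h; linarith⟩

/-! ### Integral elements of `K` up to an odd denominator. -/

theorem exists_int_eq_of_isIntegral {q : ℚ} (h : IsIntegral ℤ (q : ℂ)) : ∃ z : ℤ, (z : ℚ) = q := by
  have : IsIntegral ℤ q := (isIntegral_algebraMap_iff (A := ℚ) (B := ℂ)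
    (algebraMap ℚ ℂ).injective).1 (by simpa using h)
  simpa using IsIntegrallyClosed.isIntegral_iff.1 this

theorem isIntegral_of_sq_eq_int {s : ℂ} {k : ℤ} (h : s ^ 2 = k) : IsIntegral ℤ s := by
  refine IsIntegral.of_pow (n := 2) (by norm_num) ?_
  rw [h]
  exact isIntegral_algebraMap (R := ℤ) (x := k)

theorem isIntegral_half_one_add {s : ℂ} {k : ℤ} (h : s ^ 2 = 4 * k + 1) :
    IsIntegral ℤ ((1 + s) / 2) := by
  refine ⟨(Polynomial.X ^ 2 - Polynomial.X - Polynomial.C k : Polynomial ℤ), by monicity!, ?_⟩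
  simp only [Polynomial.eval₂_sub, Polynomial.eval₂_pow, Polynomial.eval₂_X, Polynomial.eval₂_C]
  simp only [algebraMap_int_eq, eq_intCast]
  linear_combination h / 4

/-- An integer polynomial takes values `a + b s` and `a - b s` at the two conjugates; irrationality
of `s` makes `b = 0` at a root, so the conjugate is a root of the same polynomial. -/
theorem isIntegral_conj_sqrt {s : ℂ} {k : ℤ} (hs : s ^ 2 = k) (hirr : ∀ q : ℚ, (q : ℂ) ≠ s)
    {u v : ℚ} (h : IsIntegral ℤ (u + v * s : ℂ)) : IsIntegral ℤ (u - v * s : ℂ) := by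
  obtain ⟨P, hP, hP0⟩ := h
  refine ⟨P, hP, ?_⟩
  have key : ∀ Q : Polynomial ℤ, ∃ a b : ℚ, Polynomial.eval₂ (algebraMap ℤ ℂ) (u + v * s) Q =
      a + b * s ∧ Polynomial.eval₂ (algebraMap ℤ ℂ) (u - v * s) Q = a - b * s := by
    intro Q
    induction Q using Polynomial.induction_on' with
    | add p q hp hq =>
      obtain ⟨a, b, h1, h2⟩ := hp
      obtain ⟨c, d, h3, h4⟩ := hq
      refine ⟨a + c, b + d, ?_, ?_⟩
      · rw [Polynomial.eval₂_add, h1, h3]; push_cast; ring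
      · rw [Polynomial.eval₂_add, h2, h4]; push_cast; ring
    | monomial n z =>
      simp only [Polynomial.eval₂_monomial]
      induction n with
      | zero => exact ⟨z, 0, by simp, by simp⟩
      | succ n ih =>
        obtain ⟨a, b, h1, h2⟩ := ih
        refine ⟨a * u + b * v * k, a * v + b * u, ?_, ?_⟩
        · rw [pow_succ, ← mul_assoc, h1]; push_cast; linear_combination (b * v : ℂ) * hs
        · rw [pow_succ, ← mul_assoc, h2]; push_cast; linear_combination (b * v : ℂ) * hs
  obtain ⟨a, b, h1, h2⟩ := key P
  rw [h1] at hP0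
  have hb : b = 0 := by
    by_contra hb
    refine hirr (-a / b) ?_
    have : (b : ℂ) ≠ 0 := by exact_mod_cast hb
    push_cast
    field_simp
    linear_combination -hP0
  rw [h2]
  simp only [hb, Rat.cast_zero, zero_mul, add_zero, sub_zero] at hP0 ⊢
  exact hP0

/-- `n` times an integral element of `ℚ(√n)` lies in `ℤ + ℤ (1 + √n) / 2`. -/
theorem exists_mul_eq_of_isIntegral_quadratic {n : ℕ} (hn : Squarefree n) (hn4 : n ≡ 1 [MOD 4])
    {u v : ℚ} (h : IsIntegral ℤ (u + v * (Real.sqrt n : ℂ) : ℂ)) :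
    ∃ a b : ℤ, (n : ℂ) * (u + v * (Real.sqrt n : ℂ)) = a + b * ((1 + (Real.sqrt n : ℂ)) / 2) := by
  set s : ℂ := (Real.sqrt n : ℂ) with hsdef
  have hs : s ^ 2 = ((n : ℤ) : ℂ) := by
    rw [hsdef]; norm_cast; exact Real.sq_sqrt (Nat.cast_nonneg n)
  have hn4' : n % 4 = 1 := hn4
  have hsi : IsIntegral ℤ s := isIntegral_of_sq_eq_int hs
  -- The case `n = 1` is allowed; there `√n` is rational and has no conjugation.
  by_cases hsq : IsSquare n
  · obtain ⟨r, hr⟩ := hsq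
    obtain rfl : r = 1 := Nat.isUnit_iff.1 (hn r ⟨1, by rw [hr, mul_one]⟩)
    obtain rfl : n = 1 := hr
    have hs1 : s = 1 := by simp [hsdef]
    rw [hs1] at h ⊢
    obtain ⟨z, hz⟩ := exists_int_eq_of_isIntegral (q := u + v) (by simpa using h)
    refine ⟨z, 0, ?_⟩
    have : (z : ℂ) = u + v := by exact_mod_cast congrArg (Rat.cast : ℚ → ℂ) hz
    rw [this]; push_cast; ring
  · have hirr : ∀ q : ℚ, (q : ℂ) ≠ s := by
      intro q hq
      refine (irrational_sqrt_natCast_iff.2 hsq) ⟨q, ?_⟩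
      rw [hsdef] at hq
      exact_mod_cast hq
    have h' := isIntegral_conj_sqrt hs hirr h
    -- For `z = u + v s` with conjugate `z'`, the integral element `(z - z') s` is the rational
    -- number `2 v n`.
    obtain ⟨b, hb⟩ := exists_int_eq_of_isIntegral (q := 2 * v * n) (by
      have := (h.sub h').mul hsi
      refine (congrArg (IsIntegral ℤ) ?_).mpr this
      push_cast at hs ⊢
      linear_combination (-2 * v : ℂ) * hs)
    have hb' : (b : ℂ) = 2 * v * n := by exact_mod_cast congrArg (Rat.cast : ℚ → ℂ) hb
    obtain ⟨k, hk⟩ : ∃ k, n = 4 * k + 1 := ⟨n / 4, by omega⟩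
    have hω : IsIntegral ℤ ((1 + s) / 2) := isIntegral_half_one_add (k := k) (by
      rw [hs, hk]; push_cast; ring)
    -- `n z - b (1 + s) / 2` is integral, and its `s`-part cancels.
    obtain ⟨a, ha⟩ := exists_int_eq_of_isIntegral (q := n * (u - v)) (by
      have := (IsIntegral.mul (isIntegral_algebraMap (R := ℤ) (A := ℂ) (x := (n : ℤ))) h).sub
        (IsIntegral.mul (isIntegral_algebraMap (R := ℤ) (A := ℂ) (x := b)) hω)
      refine (congrArg (IsIntegral ℤ) ?_).mpr this
      simp only [algebraMap_int_eq, eq_intCast, Int.cast_natCast]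
      rw [hb']; push_cast; ring)
    have ha' : (a : ℂ) = n * (u - v) := by exact_mod_cast congrArg (Rat.cast : ℚ → ℂ) ha
    exact ⟨a, b, by rw [ha', hb']; ring⟩

theorem exists_eq_of_mem_fieldK {m n : ℕ} {z : ℂ} (hz : z ∈ fieldK m n) :
    ∃ u₁ u₂ v₁ v₂ : ℚ, z = (u₁ + u₂ * (Real.sqrt n : ℂ)) +
      (v₁ + v₂ * (Real.sqrt n : ℂ)) * (Complex.I * (Real.sqrt m : ℂ)) := by
  have hs : (Real.sqrt n : ℂ) ^ 2 = n := by norm_cast; exact Real.sq_sqrt (Nat.cast_nonneg n)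
  have ht : (Complex.I * (Real.sqrt m : ℂ)) ^ 2 = -m := by
    rw [mul_pow, Complex.I_sq]; norm_cast; rw [Real.sq_sqrt (Nat.cast_nonneg m)]; simp
  have hint : ∀ x ∈ ({Complex.I * (Real.sqrt m : ℂ), (Real.sqrt n : ℂ)} : Set ℂ),
      IsAlgebraic ℚ x := by
    rintro x (rfl | rfl)
    · exact ((isIntegral_of_sq_eq_int (k := -m) (by rw [ht]; simp)).tower_top (A := ℚ)).isAlgebraic
    · exact ((isIntegral_of_sq_eq_int (k := n) (by rw [hs]; simp)).tower_top (A := ℚ)).isAlgebraic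
  have hz' : z ∈ Algebra.adjoin ℚ {Complex.I * (Real.sqrt m : ℂ), (Real.sqrt n : ℂ)} := by
    rw [← IntermediateField.adjoin_toSubalgebra_of_isAlgebraic hint]
    exact hz
  generalize Complex.I * (Real.sqrt m : ℂ) = t at *
  generalize (Real.sqrt n : ℂ) = s at *
  clear hz
  induction hz' using Algebra.adjoin_induction with
  | mem x hx =>
    rcases hx with rfl | rfl
    · exact ⟨0, 0, 1, 0, by simp⟩
    · exact ⟨0, 1, 0, 0, by simp⟩
  | algebraMap r => exact ⟨r, 0, 0, 0, by simp⟩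
  | add x y _ _ hx hy =>
    obtain ⟨a, b, c, d, rfl⟩ := hx
    obtain ⟨a', b', c', d', rfl⟩ := hy
    exact ⟨a + a', b + b', c + c', d + d', by push_cast; ring⟩
  | mul x y _ _ hx hy =>
    obtain ⟨a, b, c, d, rfl⟩ := hx
    obtain ⟨a', b', c', d', rfl⟩ := hy
    refine ⟨a * a' + n * b * b' - m * (c * c' + n * d * d'), a * b' + b * a' - m * (c * d' + d * c'),
      a * c' + n * b * d' + c * a' + n * d * b', a * d' + b * c' + c * b' + d * a', ?_⟩
    push_cast
    linear_combination (b * b' + (d * b' + b * d') * t + d * d' * t ^ 2 : ℂ) * hs +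
      (c * c' + (c * d' + d * c') * s + d * d' * n : ℂ) * ht

/-- `m n` times an integral element of `ℚ(√-m, √n)` is an integral combination of products of
`(1 + √-m) / 2` and `(1 + √n) / 2`. -/
theorem exists_mul_eq_of_isIntegral_fieldK {m n : ℕ} (hm4 : m ≡ 3 [MOD 4]) (hn : Squarefree n)
    (hn4 : n ≡ 1 [MOD 4]) {z : ℂ} (hz : z ∈ fieldK m n) (hint : IsIntegral ℤ z) :
    ∃ a b c d : ℤ, ((m * n : ℕ) : ℂ) * z = a + b * ((1 + (Real.sqrt n : ℂ)) / 2) +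
      (c + d * ((1 + (Real.sqrt n : ℂ)) / 2)) * ((1 + Complex.I * (Real.sqrt m : ℂ)) / 2) := by
  obtain ⟨u₁, u₂, v₁, v₂, rfl⟩ := exists_eq_of_mem_fieldK hz
  have hm4' : m % 4 = 3 := hm4
  obtain ⟨k, hk⟩ : ∃ k, m = 4 * k + 3 := ⟨m / 4, by omega⟩
  have ht : (Complex.I * (Real.sqrt m : ℂ)) ^ 2 = ((-m : ℤ) : ℂ) := by
    rw [mul_pow, Complex.I_sq]; norm_cast; rw [Real.sq_sqrt (Nat.cast_nonneg m)]; simp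
  have hconj := hint.map (starRingEnd ℂ).toIntAlgHom
  simp only [RingHom.toIntAlgHom_apply, map_add, map_mul, map_ratCast, Complex.conj_ofReal,
    Complex.conj_I, neg_mul] at hconj
  have hti := isIntegral_of_sq_eq_int ht
  have hω : IsIntegral ℤ ((1 + Complex.I * (Real.sqrt m : ℂ)) / 2) :=
    isIntegral_half_one_add (k := -k - 1) (by rw [ht, hk]; push_cast; ring)
  generalize Complex.I * (Real.sqrt m : ℂ) = t at *
  -- The same argument one level up: complex conjugation negates `t = √-m` and fixes `√n`, so `-(z -
  -- conj z) t` lies in `ℚ(√n)`.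
  have hy : IsIntegral ℤ (((2 * m * v₁ : ℚ) : ℂ) + ((2 * m * v₂ : ℚ) : ℂ) * (Real.sqrt n : ℂ)) := by
    have := ((hint.sub hconj).mul hti).neg
    refine (congrArg (IsIntegral ℤ) ?_).mpr this
    push_cast at ht ⊢
    linear_combination (2 * (v₁ + v₂ * (Real.sqrt n : ℂ)) : ℂ) * ht
  have hx : IsIntegral ℤ (((m * (u₁ - v₁) : ℚ) : ℂ) +
      ((m * (u₂ - v₂) : ℚ) : ℂ) * (Real.sqrt n : ℂ)) := by
    have := (IsIntegral.mul (isIntegral_algebraMap (R := ℤ) (A := ℂ) (x := (m : ℤ))) hint).sub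
      (hy.mul hω)
    refine (congrArg (IsIntegral ℤ) ?_).mpr this
    simp only [algebraMap_int_eq, eq_intCast, Int.cast_natCast]
    push_cast
    ring
  obtain ⟨a, b, hab⟩ := exists_mul_eq_of_isIntegral_quadratic hn hn4 hx
  obtain ⟨c, d, hcd⟩ := exists_mul_eq_of_isIntegral_quadratic hn hn4 hy
  refine ⟨a, b, c, d, ?_⟩
  rw [← hab, ← hcd]
  push_cast
  ring

theorem exists_coe_eq_of_isIntegral {K : IntermediateField ℚ ℂ} {x : ℂ} (hx : x ∈ K)
    (h : IsIntegral ℤ x) : ∃ y : 𝓞 K, ((y : K) : ℂ) = x := by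
  have : IsIntegral ℤ (⟨x, hx⟩ : K) := (isIntegral_algebraMap_iff (A := K) (B := ℂ)
    (algebraMap K ℂ).injective).1 h
  exact ⟨⟨⟨x, hx⟩, this⟩, rfl⟩

theorem coe_coe_injective {K : IntermediateField ℚ ℂ} {x y : 𝓞 K}
    (h : ((x : K) : ℂ) = ((y : K) : ℂ)) : x = y :=
  RingOfIntegers.ext (Subtype.ext h)

theorem sqrt_mem_fieldK (m n : ℕ) : (Real.sqrt n : ℂ) ∈ fieldK m n :=
  IntermediateField.subset_adjoin _ _ (by simp)

theorem I_mul_sqrt_mem_fieldK (m n : ℕ) : Complex.I * (Real.sqrt m : ℂ) ∈ fieldK m n :=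
  IntermediateField.subset_adjoin _ _ (by simp)

theorem half_one_add_mem {K : IntermediateField ℚ ℂ} {s : ℂ} (h : s ∈ K) : (1 + s) / 2 ∈ K :=
  div_mem (add_mem (one_mem K) h) (by exact_mod_cast natCast_mem K 2)

/-! ### Sums of squares when `x ^ 4 ≡ x` modulo 2. -/

/-- The set of `x` with `x ^ 4 ≡ x` modulo `2`. -/
def fixedModTwo (R : Type*) [CommRing R] : Subring R where
  carrier := {x | (2 : R) ∣ x ^ 4 - x}
  mul_mem' := by
    rintro x y ⟨a, ha⟩ ⟨b, hb⟩
    exact ⟨a * y ^ 4 + x * b, by linear_combination y ^ 4 * ha + x * hb⟩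
  one_mem' := by simp
  add_mem' := by
    rintro x y ⟨a, ha⟩ ⟨b, hb⟩
    exact ⟨a + b + 2 * x ^ 3 * y + 3 * x ^ 2 * y ^ 2 + 2 * x * y ^ 3,
      by linear_combination ha + hb⟩
  zero_mem' := by simp
  neg_mem' := by
    rintro x ⟨a, ha⟩
    exact ⟨a + x, by linear_combination ha⟩

theorem mem_fixedModTwo_of_sq {R : Type*} [CommRing R] {w : R} {k : ℤ} (h : w ^ 2 = w + k) :
    w ∈ fixedModTwo R := by
  obtain ⟨j, hj⟩ : ∃ j, k * (k + 1) = j + j := Int.even_mul_succ_self k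
  have hj' : (k : R) * (k + 1) = 2 * j := by rw [two_mul]; exact_mod_cast congrArg _ hj
  exact ⟨k * w + j, by linear_combination (w ^ 2 + w + k + 1) * h + hj'⟩

theorem mem_of_odd_mul_mem {R : Type*} [CommRing R] {N : ℕ} (hN : Odd N) {x : R}
    (h : (N : R) * x ∈ fixedModTwo R) : x ∈ fixedModTwo R := by
  obtain ⟨k, rfl⟩ := hN
  obtain ⟨a, ha⟩ := h
  have h2 : 2 * ((k : R) * x) ∈ fixedModTwo R := by
    exact ⟨8 * (k * x) ^ 4 - k * x, by ring⟩
  have : x = ((2 * k + 1 : ℕ) : R) * x - 2 * (k * x) := by push_cast; ring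
  rw [this]
  exact sub_mem ⟨a, ha⟩ h2

/-- If `x ^ 4 ≡ x` modulo `2` on `R` and `-1` is a sum of two squares, every element of `R` is a
sum of three squares. -/
theorem isSumOfSquares_three {R : Type*} [CommRing R] (hR : ∀ x : R, (2 : R) ∣ x ^ 4 - x)
    {a b : R} (hab : a ^ 2 + b ^ 2 = -1) (α : R) : IsSumOfSquares 3 α := by
  obtain ⟨d, hd⟩ := hR (1 - α)
  -- The last two squares add up to `(a² + b²)(d² + (1 - α)⁴) = -(d² + (1 - α)⁴)`.
  refine ⟨![1 + d, a * d - b * (1 - α) ^ 2, b * d + a * (1 - α) ^ 2], ?_⟩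
  simp only [Fin.sum_univ_three, Matrix.cons_val_zero, Matrix.cons_val_one, Matrix.cons_val]
  linear_combination -(d ^ 2 + (1 - α) ^ 4) * hab + hd

/-- If `x ^ 4 ≡ x` modulo `2` on `R` and `ω ^ 2 = ω + k` with `k` odd, then `1 + 2 ω` is not a
sum of two squares. -/
theorem not_sum_two_squares {R : Type*} [CommRing R] [IsDomain R] [CharZero R]
    (h2 : ¬ (2 : R) ∣ 1) (hR : ∀ x : R, (2 : R) ∣ x ^ 4 - x)
    {w : R} {k : ℤ} (hk : Odd k) (hw : w ^ 2 = w + k) (x y : R) : 1 + 2 * w ≠ x ^ 2 + y ^ 2 := by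
  intro h
  have h20 : (2 : R) ≠ 0 := two_ne_zero
  obtain ⟨j, rfl⟩ := hk
  obtain ⟨c, hc⟩ := hR (x + y)
  obtain ⟨c', hc'⟩ := hR x
  push_cast at hw
  -- Modulo 2, `(x + y)² ≡ 1`, hence `x + y ≡ (x + y)⁴ ≡ 1`.
  obtain ⟨e, he⟩ : ∃ e, x + y = 1 + 2 * e := by
    refine ⟨2 * (w + x * y) + 2 * (w + x * y) ^ 2 - c, ?_⟩
    have : (x + y) ^ 2 = 1 + 2 * (w + x * y) := by linear_combination -h
    linear_combination -hc + ((x + y) ^ 2 + 1 + 2 * (w + x * y)) * this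
  obtain rfl : y = 1 + 2 * e - x := by linear_combination he
  have hw' : w = x ^ 2 - x + 2 * (e + e ^ 2 - e * x) := by
    refine mul_left_cancel₀ h20 ?_
    linear_combination h
  generalize e + e ^ 2 - e * x = f at hw'
  -- Now `w ≡ x² - x` mod 2, so `w² - w ≡ x⁴ - x ≡ 0`, whereas `w² - w` is odd.
  refine h2 ⟨c' - x ^ 3 + x + 2 * f * (x ^ 2 - x) + 2 * f ^ 2 - f - j, ?_⟩
  rw [hw'] at hw
  linear_combination hc' - hw

theorem IsSumOfSquares.two_of_le {R : Type*} [CommRing R] {t : ℕ} (ht0 : 0 < t) (ht : t < 3)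
    {α : R} (h : IsSumOfSquares t α) : ∃ x y, α = x ^ 2 + y ^ 2 := by
  obtain ⟨β, hβ⟩ := h
  interval_cases t
  · exact ⟨β 0, 0, by simpa using hβ⟩
  · exact ⟨β 0, β 1, by simpa [Fin.sum_univ_two] using hβ⟩

theorem isIntegral_coe_coe {K : IntermediateField ℚ ℂ} (x : 𝓞 K) :
    IsIntegral ℤ ((x : K) : ℂ) :=
  (RingOfIntegers.isIntegral_coe x).algebraMap

theorem not_two_dvd_one_ringOfIntegers (K : IntermediateField ℚ ℂ) : ¬ (2 : 𝓞 K) ∣ 1 := by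
  rintro ⟨x, hx⟩
  have h : ((x : K) : ℂ) = ((1 / 2 : ℚ) : ℂ) := by
    have : (1 : ℂ) = ((x : K) : ℂ) + ((x : K) : ℂ) := by
      rw [two_mul] at hx
      exact_mod_cast congrArg (fun y : 𝓞 K => ((y : K) : ℂ)) hx
    push_cast
    linear_combination -this / 2
  obtain ⟨z, hz⟩ := exists_int_eq_of_isIntegral (h ▸ isIntegral_coe_coe x)
  have : 2 * z = 1 := by
    have : (2 : ℚ) * z = 1 := by rw [hz]; norm_num
    exact_mod_cast this
  omega

/-! ### The value of `g`. -/

theorem gEq_three {m n : ℕ} (hm8 : m % 8 = 3) (hn : Squarefree n) (hn4 : n ≡ 1 [MOD 4])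
    (hpell : ∃ u w : ℤ, u ^ 2 - m * w ^ 2 = -2) : GEq (𝓞 (fieldK m n)) 3 := by
  have hn4' : n % 4 = 1 := hn4
  obtain ⟨j, hj⟩ : ∃ j, m = 8 * j + 3 := ⟨m / 8, by omega⟩
  obtain ⟨l, hl⟩ : ∃ l, n = 4 * l + 1 := ⟨n / 4, by omega⟩
  have hs : (Real.sqrt n : ℂ) ^ 2 = ((n : ℤ) : ℂ) := by
    norm_cast; exact Real.sq_sqrt (Nat.cast_nonneg n)
  have ht : (Complex.I * (Real.sqrt m : ℂ)) ^ 2 = ((-m : ℤ) : ℂ) := by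
    rw [mul_pow, Complex.I_sq]; norm_cast; rw [Real.sq_sqrt (Nat.cast_nonneg m)]; simp
  have htj : (Complex.I * (Real.sqrt m : ℂ)) ^ 2 = -(8 * j + 3) := by rw [ht, hj]; push_cast; ring
  have hsl : (Real.sqrt n : ℂ) ^ 2 = 4 * l + 1 := by rw [hs, hl]; push_cast; ring
  obtain ⟨w₁, hw₁⟩ := exists_coe_eq_of_isIntegral (half_one_add_mem (I_mul_sqrt_mem_fieldK m n))
    (isIntegral_half_one_add (k := -j - j - 1) (by rw [htj]; push_cast; ring))
  obtain ⟨w₂, hw₂⟩ := exists_coe_eq_of_isIntegral (half_one_add_mem (sqrt_mem_fieldK m n))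
    (isIntegral_half_one_add (k := l) (by rw [hsl]; push_cast; ring))
  have hsq₁ : w₁ ^ 2 = w₁ + ((-j - j - 1 : ℤ) : 𝓞 (fieldK m n)) := by
    apply coe_coe_injective
    push_cast
    rw [hw₁]
    linear_combination htj / 4
  have hsq₂ : w₂ ^ 2 = w₂ + ((l : ℤ) : 𝓞 (fieldK m n)) := by
    apply coe_coe_injective
    push_cast
    rw [hw₂]
    linear_combination hsl / 4
  have hfix : ∀ x : 𝓞 (fieldK m n), (2 : 𝓞 (fieldK m n)) ∣ x ^ 4 - x := by
    intro x
    have hodd : Odd (m * n) := (Nat.odd_iff.2 (by omega)).mul (Nat.odd_iff.2 (by omega))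
    -- The congruence holds for `w₁` and `w₂`, hence on the subring they generate, which contains `m
    -- n x`; the odd factor `m n` is harmless modulo 2.
    refine mem_of_odd_mul_mem hodd ?_
    obtain ⟨a, b, c, d, h⟩ := exists_mul_eq_of_isIntegral_fieldK (m := m) (n := n)
      (by show m % 4 = 3; omega) hn hn4 (x : fieldK m n).2 (isIntegral_coe_coe x)
    have : ((m * n : ℕ) : 𝓞 (fieldK m n)) * x = a + b * w₂ + (c + d * w₂) * w₁ := by
      apply coe_coe_injective
      push_cast
      rw [hw₁, hw₂]
      push_cast at h
      exact h
    rw [this]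
    have h₁ := mem_fixedModTwo_of_sq hsq₁
    have h₂ := mem_fixedModTwo_of_sq hsq₂
    exact add_mem (add_mem (intCast_mem _ a) (mul_mem (intCast_mem _ b) h₂))
      (mul_mem (add_mem (intCast_mem _ c) (mul_mem (intCast_mem _ d) h₂)) h₁)
  constructor
  · refine ⟨by norm_num, ?_⟩
    obtain ⟨u, w, huw⟩ := hpell
    obtain ⟨e, he⟩ : ∃ e, u = w + 2 * e := by
      have : (u - w) % 2 = 0 := by
        have h1 := Int.emod_two_eq_zero_or_one u
        have h2 := Int.emod_two_eq_zero_or_one w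
        have h3 : (u ^ 2 - (8 * j + 3 : ℤ) * w ^ 2) % 2 = 0 := by
          rw [hj] at huw; push_cast at huw; omega
        rcases h1 with h1 | h1 <;> rcases h2 with h2 | h2 <;>
          simp [pow_two, Int.sub_emod, Int.mul_emod, Int.add_emod, h1, h2] at h3 ⊢
      exact ⟨(u - w) / 2, by omega⟩
    have huw' : ((w : 𝓞 (fieldK m n)) + 2 * e) ^ 2 - (8 * j + 3) * w ^ 2 = -2 := by
      rw [he, hj] at huw
      exact_mod_cast congrArg (Int.cast : ℤ → 𝓞 (fieldK m n)) huw
    -- With `u = w + 2e`, these are `a = (u + w√-m)/2` and `b = (-u + w√-m)/2`.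
    refine isSumOfSquares_three hfix (a := e + w * w₁) (b := -(e + w) + w * w₁) ?_
    refine mul_left_cancel₀ (two_ne_zero (α := 𝓞 (fieldK m n))) ?_
    push_cast at hsq₁
    linear_combination 4 * w ^ 2 * hsq₁ + huw'
  · rintro t ⟨ht0, ht⟩
    by_contra! hlt
    obtain ⟨x, y, hxy⟩ := (ht (1 + 2 * w₁)).two_of_le ht0 hlt
    exact not_sum_two_squares (not_two_dvd_one_ringOfIntegers _) hfix
      (k := -j - j - 1) ⟨-j - 1, by ring⟩ hsq₁ x y hxy

theorem mainTheorem4 (m n : ℕ) (hm : Squarefree m) (hn : Squarefree n) (hmn : m ≠ n)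
    (hm4 : m ≡ 3 [MOD 4]) (hn4 : n ≡ 1 [MOD 4]) :
    (∀ (p : ℕ) [Fact p.Prime], m = p → p ≡ 3 [MOD 8] →
      GEq (𝓞 (fieldK m n)) 3) ∧
    (∀ (p q : ℕ) [Fact p.Prime] [Fact q.Prime], p ≠ q → m = p * q →
      p ≡ 3 [MOD 8] → q ≡ 1 [MOD 8] →
      legendreSym q p = -1 →
      GEq (𝓞 (fieldK m n)) 3) ∧
    (∀ (p q r : ℕ) [Fact p.Prime] [Fact q.Prime] [Fact r.Prime],
      p ≠ q → q ≠ r → r ≠ p → m = p * q * r →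
      p ≡ 3 [MOD 8] → q ≡ 3 [MOD 8] → r ≡ 3 [MOD 8] →
      legendreSym q p = -1 → legendreSym r q = -1 → legendreSym p r = -1 →
      GEq (𝓞 (fieldK m n)) 3) := by
  refine ⟨?_, ?_, ?_⟩
  · rintro p _ rfl hp
    exact gEq_three hp hn hn4 (neg_pell_prime hp)
  · rintro p q _ _ - rfl hp hq hpq
    exact gEq_three (hp.mul hq) hn hn4 (neg_pell_two_primes hp hq hpq)
  · rintro p q r _ _ _ - - - rfl hp hq hr hpq hqr hrp
    exact gEq_three ((hp.mul hq).mul hr) hn hn4 (neg_pell_three_primes hp hq hr hpq hqr hrp)
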